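/- For $r\ge 2$ and $m\ge 0$ let $K_{r\times(r-1)m}$ be the complete $r$-partite graph whose $r$ vertex classes each have $(r-1)m$ vertices. Call a perfect matching of a spanning subgraph $G$ of $K_{r\times(r-1)m}$ *balanced* if it has the same number of edges between every two of the $r$ classes, and let $\mathrm{bpm}(G)$ be the number of balanced perfect matchings of $G$. **Theorem.** Fix an integer $r\ge 3$, and for each $m$ let $M=M_m$ be any perfect matching (balanced or not) of $K_{r\times(r-1)m}$. Write $K_{r\times(r-1)m}-M$ for the graph obtained by deleting the edges of $M$. Then $$\lim_{m\to\infty}\frac{\mathrm{bpm}\bigl(K_{r\times(r-1)m}-M\bigr)}{\mathrm{bpm}\bigl(K_{r\times(r-1)m}\bigr)}=e^{-r/(2r-2)}.$$ -/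

import Mathlib

/-- Edges of the subgraph `M` joining class `i` to class `j`, where `c v` is the class of the vertex
`v`. -/
def edgesBetween {V ι : Type*} {G : SimpleGraph V} (c : V → ι) (M : G.Subgraph) (i j : ι) :
    Set (Sym2 V) :=
  {e | e ∈ M.edgeSet ∧ e.map c = s(i, j)}

/-- A balanced perfect matching of `G` with respect to the classes given by `c`: a perfect matching
having the same number of edges between every two distinct classes. -/
def IsBalancedPerfectMatching {V ι : Type*} {G : SimpleGraph V} (c : V → ι) (M : G.Subgraph) :
    Prop :=
  M.IsPerfectMatching ∧ ∃ k : ℕ, ∀ i j : ι, i ≠ j → (edgesBetween c M i j).ncard = k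

/-- The number of balanced perfect matchings of `G` with respect to the classes given by `c`. -/
noncomputable def bpm {V ι : Type*} (G : SimpleGraph V) (c : V → ι) : ℕ :=
  {M : G.Subgraph | IsBalancedPerfectMatching c M}.ncard

/-! Encode perfect matchings as involutions: `g` for `M`, `f` for a balanced one, and let `R` hold
one endpoint of each edge of `M`, the one in the lower class. Write n = (r-1)m for the class size.
Inclusion-exclusion over the edges of `M` contained in `f` gives the ratio as an alternating sum of
binomial moments: the k-th is the sum, over k-subsets `S` of `R`, of the proportion of balanced
matchings containing the edges at `S`.

Permuting vertices within classes shows that, given the edges at `S`, all uncovered pairs from two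
given classes are equally likely to be matched. Double counting then makes each further edge cost
the exact factor (m - s)/(ab), where s edges between the two classes are already prescribed and a, b
vertices are free in them (`card_extensions_insert_mul`). For fixed k each proportion is asymptotic
to (m/n²)^k, whatever `M` is. As |R| = rn/2, the k-th moment tends to l^k/k! with l = r/(2(r-1)).

Exchanging limit and sum needs a summable bound valid for all k, even k comparable to n. Keeping the
free-vertex counts as falling factorials, and using n^s ≤ e^s · n(n-1)⋯(n-s+1), bounds the moments
by (e²l)^k/k!. Dominated convergence yields the sum of (-l)^k/k!, which is exp(-l). -/

open Finset

/-! ### Prescribing edges: symmetry, double counting, inclusion-exclusion -/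

section Involutions

open scoped Classical

variable {V ι : Type*} [Fintype V] [LinearOrder ι]

/-- A fixed-point-free involution of `V` encoding a perfect matching that joins distinct classes and
has exactly `m` edges between every two distinct classes. -/
def IsBalancedInvolution (c : V → ι) (m : ℕ) (f : V → V) : Prop :=
  Function.Involutive f ∧ (∀ v, c (f v) ≠ c v) ∧
    ∀ i j, i ≠ j → #{x | c x = i ∧ c (f x) = j} = m

/-- The balanced involutions agreeing with `g` on `S`. -/
noncomputable def balancedExtensions (c : V → ι) (m : ℕ) (g : V → V) (S : Finset V) :
    Finset (V → V) :=
  {f | IsBalancedInvolution c m f ∧ ∀ v ∈ S, f v = g v}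

/-- The balanced involutions agreeing with `g` nowhere on `R`. -/
noncomputable def balancedAvoiding (c : V → ι) (m : ℕ) (g : V → V) (R : Finset V) :
    Finset (V → V) :=
  {f | IsBalancedInvolution c m f ∧ ∀ v ∈ R, f v ≠ g v}

/-- The vertices of class `i` covered by the edges `{v, g v}` with `v ∈ S`. -/
noncomputable def coveredVertices (c : V → ι) (g : V → V) (S : Finset V) (i : ι) : Finset V :=
  {x | c x = i ∧ (x ∈ S ∨ g x ∈ S)}

/-- The vertices of class `i` not covered by the edges `{v, g v}` with `v ∈ S`. -/
noncomputable def freeVertices (c : V → ι) (g : V → V) (S : Finset V) (i : ι) : Finset V :=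
  {x | c x = i ∧ ¬ (x ∈ S ∨ g x ∈ S)}

theorem IsBalancedInvolution.conj {c : V → ι} {m : ℕ} {f : V → V}
    (hf : IsBalancedInvolution c m f) (σ : Equiv.Perm V) (hσ : ∀ v, c (σ v) = c v) :
    IsBalancedInvolution c m (fun x => σ (f (σ.symm x))) := by
  have hσ' : ∀ v, c (σ.symm v) = c v := fun v => by
    rw [← hσ (σ.symm v), Equiv.apply_symm_apply]
  refine ⟨fun x => by simp [hf.1 _], fun v => ?_, fun i j hij => ?_⟩
  · rw [hσ, ← hσ' v]; exact hf.2.1 _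
  · rw [← hf.2.2 i j hij]
    refine card_bij (fun x _ => σ.symm x) (fun x hx => ?_) (fun x _ y _ h => σ.symm.injective h)
      fun y hy => ⟨σ y, ?_, by simp⟩
    · simpa [hσ, hσ'] using hx
    · simpa [hσ, hσ'] using hy

theorem card_covered_add_card_free (c : V → ι) (g : V → V) (S : Finset V) (i : ι) :
    #(coveredVertices c g S i) + #(freeVertices c g S i) = #{x | c x = i} := by
  unfold coveredVertices freeVertices
  rw [← filter_filter, ← filter_filter]
  exact card_filter_add_card_filter_not _

/-- Conjugation by a class-preserving permutation that fixes all covered vertices and carries (x, y)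
to (v, g v) is a bijection between the two families. Hence every free pair is matched equally often.
-/
theorem card_extensions_apply_eq (c : V → ι) (m : ℕ) {g : V → V} (hg : Function.Involutive g)
    (S : Finset V) {v x y : V} (hv : v ∈ freeVertices c g S (c v)) (hne : c v ≠ c (g v))
    (hx : x ∈ freeVertices c g S (c v)) (hy : y ∈ freeVertices c g S (c (g v))) :
    #{f ∈ balancedExtensions c m g S | f x = y} = #(balancedExtensions c m g (insert v S)) := by
  simp only [freeVertices, mem_filter, mem_univ, true_and, not_or] at hv hx hy
  -- Both transpositions stay inside one class and move only free vertices.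
  set σ : Equiv.Perm V := Equiv.swap x v * Equiv.swap y (g v) with hσdef
  have hxy : x ≠ y := fun h => hne (by rw [← hx.1, ← hy.1, h])
  have hvy : v ≠ y := fun h => hne (by rw [← hy.1, ← h])
  have hxg : x ≠ g v := fun h => hne (by rw [← hx.1, ← h])
  have hvg : v ≠ g v := fun h => hne (by rw [← h])
  have hσ : ∀ w, c (σ w) = c w := by
    have hs : ∀ a b : V, c a = c b → ∀ w, c (Equiv.swap a b w) = c w := fun a b hab w => by
      rw [Equiv.swap_apply_def]
      split_ifs with h1 h2
      · rw [h1, hab]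
      · rw [h2, hab]
      · rfl
    intro w
    rw [hσdef, Equiv.Perm.mul_apply, hs x v hx.1, hs y (g v) hy.1]
  have hσx : σ x = v := by
    rw [hσdef, Equiv.Perm.mul_apply, Equiv.swap_apply_of_ne_of_ne hxy hxg, Equiv.swap_apply_left]
  have hσy : σ y = g v := by
    rw [hσdef, Equiv.Perm.mul_apply, Equiv.swap_apply_left,
      Equiv.swap_apply_of_ne_of_ne hxg.symm hvg.symm]
  have hσfix : ∀ w, (w ∈ S ∨ g w ∈ S) → σ w = w := by
    intro w hw
    have h1 : w ≠ x := by rintro rfl; tauto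
    have h2 : w ≠ y := by rintro rfl; tauto
    have h3 : w ≠ v := by rintro rfl; tauto
    have h4 : w ≠ g v := by rintro rfl; rw [hg] at hw; tauto
    rw [hσdef, Equiv.Perm.mul_apply, Equiv.swap_apply_of_ne_of_ne h2 h4,
      Equiv.swap_apply_of_ne_of_ne h1 h3]
  have hsymm : ∀ w, c (σ.symm w) = c w := fun w => by
    rw [← hσ (σ.symm w), Equiv.apply_symm_apply]
  have hsymmfix : ∀ w, (w ∈ S ∨ g w ∈ S) → σ.symm w = w := fun w hw => by
    rw [Equiv.symm_apply_eq, hσfix w hw]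
  refine card_nbij' (fun f w => σ (f (σ.symm w))) (fun f w => σ.symm (f (σ w))) ?_ ?_ ?_ ?_
  · intro f hf
    simp only [balancedExtensions, coe_filter, Set.mem_ofPred_eq, mem_filter, mem_univ, true_and,
      mem_insert, forall_eq_or_imp] at hf ⊢
    refine ⟨hf.1.1.conj σ hσ, ?_, fun w hw => ?_⟩
    · rw [← hσx, Equiv.symm_apply_apply, hf.2, hσy, hσx]
    · rw [hsymmfix w (.inl hw), hf.1.2 w hw, hσfix _ (.inr (by rwa [hg w]))]
  · intro f hf
    simp only [balancedExtensions, coe_filter, Set.mem_ofPred_eq, mem_filter, mem_univ, true_and,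
      mem_insert, forall_eq_or_imp] at hf ⊢
    refine ⟨⟨?_, fun w hw => ?_⟩, ?_⟩
    · simpa using hf.1.conj σ.symm hsymm
    · rw [hσfix w (.inl hw), hf.2.2 w hw, hsymmfix _ (.inr (by rwa [hg w]))]
    · rw [hσx, hf.2.1, ← hσy, Equiv.symm_apply_apply]
  · intro f _; simp
  · intro f _; simp

/-- Of the m edges of `f` between the two classes, those meeting a covered vertex are exactly the
edges prescribed by `S`. The orientation `hS` ensures that each of these is recorded at its endpoint
in class `i`. -/
theorem card_free_pairs_of_mem_extensions {c : V → ι} {m : ℕ} {g : V → V}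
    (hg : Function.Involutive g) {S : Finset V} (hS : ∀ w ∈ S, c w < c (g w)) {i j : ι}
    (hij : i < j) {f : V → V} (hf : f ∈ balancedExtensions c m g S) :
    #{p ∈ freeVertices c g S i ×ˢ freeVertices c g S j | f p.1 = p.2} =
      m - #{w ∈ S | c w = i ∧ c (g w) = j} := by
  simp only [balancedExtensions, mem_filter, mem_univ, true_and] at hf
  obtain ⟨hbal, hfS⟩ := hf
  have hcov : ∀ x, (x ∈ S ∨ g x ∈ S) → f x = g x := by
    rintro x (hx | hx)
    · exact hfS x hx
    · have := hfS _ hx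
      rw [hg] at this
      rw [← hbal.1 (g x), this]
  have hsub : {w ∈ S | c w = i ∧ c (g w) = j} ⊆ ({x | c x = i ∧ c (f x) = j} : Finset V) := by
    intro w hw
    simp only [mem_filter, mem_univ, true_and] at hw ⊢
    rw [hfS w hw.1]; exact hw.2
  rw [← hbal.2.2 i j hij.ne, ← card_sdiff_of_subset hsub]
  refine card_bij (fun p _ => p.1) ?_ ?_ ?_
  · rintro ⟨x, y⟩ h
    simp only [freeVertices, mem_filter, mem_univ, true_and, mem_product, mem_sdiff] at h ⊢
    obtain ⟨⟨⟨h1, h2⟩, h3, h4⟩, h5⟩ := h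
    rw [h5]
    tauto
  · rintro ⟨x, y⟩ h ⟨x', y'⟩ h' hxx
    simp only [mem_filter] at h h' hxx
    rw [Prod.mk.injEq, ← h.2, ← h'.2, hxx]
    exact ⟨rfl, rfl⟩
  · intro x hx
    simp only [mem_filter, mem_univ, true_and, mem_sdiff] at hx
    obtain ⟨⟨h1, h2⟩, h3⟩ := hx
    have hxfree : ¬ (x ∈ S ∨ g x ∈ S) := by
      intro hx
      rw [hcov x hx] at h2
      rcases hx with hx | hx
      · exact h3 ⟨hx, h1, h2⟩
      · have := hS _ hx
        rw [hg, h1, h2] at this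
        exact lt_asymm this hij
    have hfxfree : ¬ (f x ∈ S ∨ g (f x) ∈ S) := by
      intro h
      have h' := hcov _ h
      rw [hbal.1] at h'
      apply hxfree
      rw [h', hg]
      exact h.symm
    refine ⟨(x, f x), ?_, rfl⟩
    simp only [freeVertices, mem_filter, mem_univ, true_and, mem_product, and_true]
    exact ⟨⟨h1, hxfree⟩, h2, hfxfree⟩

/-- Double count incidences between extensions `f` of `S` and free pairs matched by `f`, in the two
classes of the new edge. -/
theorem card_extensions_insert_mul (c : V → ι) (m : ℕ) {g : V → V} (hg : Function.Involutive g)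
    {S : Finset V} (hS : ∀ w ∈ S, c w < c (g w)) {v : V} (hvS : v ∉ S) (hv : c v < c (g v)) :
    #(balancedExtensions c m g (insert v S)) *
        (#(freeVertices c g S (c v)) * #(freeVertices c g S (c (g v)))) =
      #(balancedExtensions c m g S) * (m - #{w ∈ S | c w = c v ∧ c (g w) = c (g v)}) := by
  have hgv : g v ∉ S := fun h => by
    have := hS _ h
    rw [hg] at this
    exact lt_asymm hv this
  have hfree : v ∈ freeVertices c g S (c v) := by simp [freeVertices, hvS, hgv]
  have key := sum_card_bipartiteAbove_eq_sum_card_bipartiteBelow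
    (s := balancedExtensions c m g S)
    (t := freeVertices c g S (c v) ×ˢ freeVertices c g S (c (g v)))
    (fun f p => f p.1 = p.2)
  simp only [bipartiteAbove, bipartiteBelow] at key
  rw [sum_congr rfl (fun f hf => card_free_pairs_of_mem_extensions hg hS hv hf),
    sum_congr rfl (fun p hp => card_extensions_apply_eq c m hg S hfree hv.ne
      (mem_product.1 hp).1 (mem_product.1 hp).2)] at key
  rw [sum_const, sum_const, smul_eq_mul, smul_eq_mul, card_product] at key
  rw [key, mul_comm]

theorem card_covered_insert (c : V → ι) {g : V → V} (hg : Function.Involutive g)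
    {S : Finset V} (hS : ∀ w ∈ S, c w < c (g w)) {v : V} (hvS : v ∉ S) (hv : c v < c (g v))
    (i : ι) :
    #(coveredVertices c g (insert v S) i) = #(coveredVertices c g S i) +
      ((if c v = i then 1 else 0) + if c (g v) = i then 1 else 0) := by
  have hgv : g v ∉ S := fun h => by
    have := hS _ h
    rw [hg] at this
    exact lt_asymm hv this
  have hvg : v ≠ g v := fun h => hv.ne (by rw [← h])
  have h : coveredVertices c g (insert v S) i =
      coveredVertices c g S i ∪ ({x ∈ {v, g v} | c x = i} : Finset V) := by
    ext x
    have : g x = v ↔ x = g v := ⟨fun h => by rw [← h, hg], fun h => by rw [h, hg]⟩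
    simp only [coveredVertices, mem_filter, mem_univ, true_and, mem_insert, mem_union,
      mem_singleton, this]
    tauto
  rw [h, card_union_of_disjoint, filter_insert, filter_singleton]
  · congr 1
    split_ifs with h1 h2 <;> simp_all
  · rw [disjoint_left]
    intro x hx hx'
    simp only [coveredVertices, mem_filter, mem_univ, true_and, mem_insert, mem_singleton] at hx hx'
    rcases hx'.1 with rfl | rfl
    · tauto
    · rw [hg] at hx; tauto

/-- For each `f`, the subsets of `R` on which `f` agrees with `g` form the powerset of the agreement
set, whose alternating sum vanishes unless that set is empty. -/
theorem card_balancedAvoiding (c : V → ι) (m : ℕ) (g : V → V) (R : Finset V) :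
    (#(balancedAvoiding c m g R) : ℤ) =
      ∑ S ∈ R.powerset, (-1) ^ #S * (#(balancedExtensions c m g S) : ℤ) := by
  have h1 : ∀ f : V → V, ∑ S ∈ R.powerset, (-1 : ℤ) ^ #S * (if ∀ v ∈ S, f v = g v then 1 else 0) =
      if ∀ v ∈ R, f v ≠ g v then 1 else 0 := by
    intro f
    have h2 : ({S ∈ R.powerset | ∀ v ∈ S, f v = g v} : Finset (Finset V)) =
        ({v ∈ R | f v = g v} : Finset V).powerset := by
      ext S
      simp only [mem_filter, mem_powerset, subset_iff]
      exact ⟨fun h v hv => ⟨h.1 hv, h.2 v hv⟩, fun h => ⟨fun v hv => (h hv).1, fun v hv => (h hv).2⟩⟩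
    simp only [mul_ite, mul_one, mul_zero]
    rw [← sum_filter, h2, sum_powerset_neg_one_pow_card]
    simp [filter_eq_empty_iff]
  simp only [balancedAvoiding, balancedExtensions, ← filter_filter, card_filter _ (filter _ _), Nat.cast_sum,
    Nat.cast_ite, Nat.cast_one, Nat.cast_zero, mul_sum]
  rw [sum_comm]
  exact sum_congr rfl fun f _ => (h1 f).symm

end Involutions

/-! ### Bounds on the proportion of matchings containing given edges -/

section Bounds

open scoped Classical

variable {V ι : Type*} [Fintype V] [LinearOrder ι]

theorem card_covered_le (c : V → ι) {g : V → V} (hg : Function.Involutive g) (S : Finset V)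
    (i : ι) : #(coveredVertices c g S i) ≤ 2 * #S := by
  have h : coveredVertices c g S i ⊆ S ∪ S.image g := by
    intro x hx
    simp only [coveredVertices, mem_filter, mem_univ, true_and] at hx
    rw [mem_union, mem_image]
    exact hx.2.imp id fun h => ⟨g x, h, hg x⟩
  calc _ ≤ #(S ∪ S.image g) := card_le_card h
    _ ≤ #S + #(S.image g) := card_union_le S (S.image g)
    _ ≤ #S + #S := Nat.add_le_add_left (card_image_le (s := S) (f := g)) _
    _ = 2 * #S := by ring

/-- `K` stays fixed during the induction so that every added edge contributes the same factor. This
is sharp for bounded `K`, but trivial for nonempty `S` once 2K ≥ n, where the truncated subtraction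
gives 0. -/
theorem card_extensions_mul_pow_le {c : V → ι} {n : ℕ} (hn : ∀ i, #{x | c x = i} = n) (m : ℕ)
    {g : V → V} (hg : Function.Involutive g) {K : ℕ} {S : Finset V}
    (hS : ∀ w ∈ S, c w < c (g w)) (hK : #S ≤ K) :
    #(balancedExtensions c m g S) * (n - 2 * K) ^ (2 * #S) ≤
      #(balancedExtensions c m g ∅) * m ^ #S := by
  induction S using Finset.induction_on with
  | empty => simp
  | insert v S hv ih =>
    rw [card_insert_of_notMem hv] at hK ⊢
    have hS' : ∀ w ∈ S, c w < c (g w) := fun w hw => hS w (mem_insert_of_mem hw)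
    have ih := ih hS' (by omega)
    have step := card_extensions_insert_mul c m hg hS' hv (hS v (mem_insert_self v S))
    have hfree : ∀ i, n - 2 * K ≤ #(freeVertices c g S i) := fun i => by
      have h1 := card_covered_add_card_free c g S i
      have h2 := card_covered_le c hg S i
      rw [hn] at h1
      omega
    calc _ = #(balancedExtensions c m g (insert v S)) * ((n - 2 * K) * (n - 2 * K)) *
          (n - 2 * K) ^ (2 * #S) := by ring
      _ ≤ #(balancedExtensions c m g (insert v S)) *
          (#(freeVertices c g S (c v)) * #(freeVertices c g S (c (g v)))) *
          (n - 2 * K) ^ (2 * #S) := by gcongr <;> exact hfree _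
      _ ≤ #(balancedExtensions c m g S) * m * (n - 2 * K) ^ (2 * #S) := by
          rw [step]; gcongr; exact Nat.sub_le _ _
      _ = #(balancedExtensions c m g S) * (n - 2 * K) ^ (2 * #S) * m := by ring
      _ ≤ #(balancedExtensions c m g ∅) * m ^ #S * m := by gcongr
      _ = _ := by ring

theorem le_card_extensions_mul_pow {c : V → ι} {n : ℕ} (hn : ∀ i, #{x | c x = i} = n) (m : ℕ)
    {g : V → V} (hg : Function.Involutive g) {K : ℕ} {S : Finset V}
    (hS : ∀ w ∈ S, c w < c (g w)) (hK : #S ≤ K) :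
    #(balancedExtensions c m g ∅) * (m - K) ^ #S ≤
      #(balancedExtensions c m g S) * n ^ (2 * #S) := by
  induction S using Finset.induction_on with
  | empty => simp
  | insert v S hv ih =>
    rw [card_insert_of_notMem hv] at hK ⊢
    have hS' : ∀ w ∈ S, c w < c (g w) := fun w hw => hS w (mem_insert_of_mem hw)
    have ih := ih hS' (by omega)
    have step := card_extensions_insert_mul c m hg hS' hv (hS v (mem_insert_self v S))
    have hfree : ∀ i, #(freeVertices c g S i) ≤ n := fun i => by
      have h1 := card_covered_add_card_free c g S i
      rw [hn] at h1
      omega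
    have hm : m - K ≤ m - #{w ∈ S | c w = c v ∧ c (g w) = c (g v)} := by
      have := card_filter_le S (fun w => c w = c v ∧ c (g w) = c (g v))
      omega
    calc _ = #(balancedExtensions c m g ∅) * (m - K) ^ #S * (m - K) := by ring
      _ ≤ #(balancedExtensions c m g S) * n ^ (2 * #S) * (m - K) := by gcongr
      _ = #(balancedExtensions c m g S) * (m - K) * n ^ (2 * #S) := by ring
      _ ≤ #(balancedExtensions c m g S) * (m - #{w ∈ S | c w = c v ∧ c (g w) = c (g v)}) *
          n ^ (2 * #S) := by gcongr
      _ = #(balancedExtensions c m g (insert v S)) *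
          (#(freeVertices c g S (c v)) * #(freeVertices c g S (c (g v)))) * n ^ (2 * #S) := by
          rw [step]
      _ ≤ #(balancedExtensions c m g (insert v S)) * (n * n) * n ^ (2 * #S) := by
          gcongr <;> exact hfree _
      _ = _ := by ring

/-- Induction on s with a = n - s fixed. The step uses (1 + 1/x)^s ≤ exp(s/x) ≤ e for s ≤ x = a + s.
-/
theorem pow_le_exp_mul_descFactorial {n s : ℕ} (h : s ≤ n) :
    (n : ℝ) ^ s ≤ Real.exp 1 ^ s * n.descFactorial s := by
  obtain ⟨a, rfl⟩ := Nat.exists_eq_add_of_le' h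
  clear h
  induction s with
  | zero => simp
  | succ s ih =>
    have h1 : ((a + s : ℕ) + 1 : ℝ) ^ s ≤ Real.exp 1 * (a + s : ℕ) ^ s := by
      rcases Nat.eq_zero_or_pos s with rfl | hs
      · simp
      have hx : (0 : ℝ) < (a + s : ℕ) := by positivity
      have hsx : (s : ℝ) ≤ (a + s : ℕ) := by push_cast; linarith [(Nat.cast_nonneg a : (0:ℝ) ≤ a)]
      generalize ((a + s : ℕ) : ℝ) = x at hx hsx
      calc (x + 1) ^ s = (x⁻¹ + 1) ^ s * x ^ s := by rw [← mul_pow]; congr 1; field_simp; ring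
        _ ≤ Real.exp x⁻¹ ^ s * x ^ s := by gcongr; exact Real.add_one_le_exp _
        _ ≤ Real.exp 1 * x ^ s := by
          rw [← Real.exp_nat_mul]
          gcongr
          rwa [← div_eq_mul_inv, div_le_one hx]
    rw [← add_assoc, Nat.succ_descFactorial_succ]
    push_cast at h1 ih ⊢
    calc ((a : ℝ) + s + 1) ^ (s + 1) = (a + s + 1) * (a + s + 1) ^ s := by ring
      _ ≤ (a + s + 1) * (Real.exp 1 * (a + s) ^ s) := by gcongr
      _ ≤ (a + s + 1) * (Real.exp 1 * (Real.exp 1 ^ s * (a + s).descFactorial s)) := by gcongr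
      _ = _ := by ring

variable [Fintype ι]

theorem sum_card_covered (c : V → ι) {g : V → V} (hg : Function.Involutive g)
    {S : Finset V} (hS : ∀ w ∈ S, c w < c (g w)) :
    ∑ i, #(coveredVertices c g S i) = 2 * #S := by
  induction S using Finset.induction_on with
  | empty => simp [coveredVertices]
  | insert v S hv ih =>
    have hS' : ∀ w ∈ S, c w < c (g w) := fun w hw => hS w (mem_insert_of_mem hw)
    rw [sum_congr rfl fun i _ =>
      card_covered_insert c hg hS' hv (hS v (mem_insert_self v S)) i, sum_add_distrib,
      ih hS', sum_add_distrib, card_insert_of_notMem hv]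
    simp
    ring

/-- A new edge covers one more vertex in each of two distinct classes, so the free-vertex counts
accumulate into falling factorials. Unlike the bound with a fixed `K`, this one remains useful for
large `S`. -/
theorem card_extensions_mul_prod_descFactorial_le {c : V → ι} {n : ℕ}
    (hn : ∀ i, #{x | c x = i} = n) (m : ℕ)
    {g : V → V} (hg : Function.Involutive g) {S : Finset V} (hS : ∀ w ∈ S, c w < c (g w)) :
    #(balancedExtensions c m g S) * ∏ i, n.descFactorial #(coveredVertices c g S i) ≤
      #(balancedExtensions c m g ∅) * m ^ #S := by
  induction S using Finset.induction_on with
  | empty => simp [coveredVertices]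
  | insert v S hv ih =>
    have hS' : ∀ w ∈ S, c w < c (g w) := fun w hw => hS w (mem_insert_of_mem hw)
    have hvlt := hS v (mem_insert_self v S)
    have ih := ih hS'
    have step := card_extensions_insert_mul c m hg hS' hv hvlt
    have hfree : ∀ i, n - #(coveredVertices c g S i) = #(freeVertices c g S i) := fun i => by
      have h1 := card_covered_add_card_free c g S i
      rw [hn] at h1
      omega
    have hprod : ∏ i, n.descFactorial #(coveredVertices c g (insert v S) i) =
        (∏ i, n.descFactorial #(coveredVertices c g S i)) *
          (#(freeVertices c g S (c v)) * #(freeVertices c g S (c (g v)))) := by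
      have h : ∀ i, n.descFactorial #(coveredVertices c g (insert v S) i) =
          n.descFactorial #(coveredVertices c g S i) *
            ((if c v = i then #(freeVertices c g S i) else 1) *
              (if c (g v) = i then #(freeVertices c g S i) else 1)) := by
        intro i
        rw [card_covered_insert c hg hS' hv hvlt, ← hfree]
        split_ifs with h1 h2 h2
        · exact absurd (h1.trans h2.symm) hvlt.ne
        all_goals simp [Nat.descFactorial_succ, mul_comm]
      rw [prod_congr rfl fun i _ => h i, prod_mul_distrib, prod_mul_distrib]
      simp
    rw [hprod, card_insert_of_notMem hv]
    calc _ = #(balancedExtensions c m g (insert v S)) *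
          (#(freeVertices c g S (c v)) * #(freeVertices c g S (c (g v)))) *
          ∏ i, n.descFactorial #(coveredVertices c g S i) := by ring
      _ ≤ #(balancedExtensions c m g S) * m *
          ∏ i, n.descFactorial #(coveredVertices c g S i) := by
          rw [step]; gcongr; exact Nat.sub_le _ _
      _ = #(balancedExtensions c m g S) *
          (∏ i, n.descFactorial #(coveredVertices c g S i)) * m := by ring
      _ ≤ #(balancedExtensions c m g ∅) * m ^ #S * m := by gcongr
      _ = _ := by ring

theorem card_extensions_mul_pow_le_exp {c : V → ι} {n : ℕ} (hn : ∀ i, #{x | c x = i} = n)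
    (m : ℕ) {g : V → V} (hg : Function.Involutive g) {S : Finset V}
    (hS : ∀ w ∈ S, c w < c (g w)) :
    (#(balancedExtensions c m g S) : ℝ) * (n : ℝ) ^ (2 * #S) ≤
      Real.exp 1 ^ (2 * #S) * (#(balancedExtensions c m g ∅) * (m : ℝ) ^ #S) := by
  have h := card_extensions_mul_prod_descFactorial_le hn m hg hS
  have h' : (#(balancedExtensions c m g S) : ℝ) *
      ∏ i, (n.descFactorial #(coveredVertices c g S i) : ℝ) ≤
      #(balancedExtensions c m g ∅) * (m : ℝ) ^ #S := by exact_mod_cast h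
  rw [← sum_card_covered c hg hS, ← prod_pow_eq_pow_sum, ← prod_pow_eq_pow_sum]
  have hle : ∀ i, #(coveredVertices c g S i) ≤ n := fun i => by
    have h1 := card_covered_add_card_free c g S i
    rw [hn] at h1
    omega
  calc _ ≤ (#(balancedExtensions c m g S) : ℝ) * ∏ i, (Real.exp 1 ^ #(coveredVertices c g S i) *
        (n.descFactorial #(coveredVertices c g S i) : ℝ)) := by
        gcongr with i _
        exact pow_le_exp_mul_descFactorial (hle i)
    _ = (∏ i, Real.exp 1 ^ #(coveredVertices c g S i)) * ((#(balancedExtensions c m g S) : ℝ) *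
        ∏ i, (n.descFactorial #(coveredVertices c g S i) : ℝ)) := by
        rw [prod_mul_distrib]; ring
    _ ≤ _ := by gcongr

/-- `g` exchanges lower and upper endpoints, so the lower ones are half of all vertices. -/
theorem two_mul_card_lower_endpoints {c : V → ι} {n : ℕ} (hn : ∀ i, #{x | c x = i} = n)
    {g : V → V} (hg : Function.Involutive g) (hgc : ∀ v, c (g v) ≠ c v) :
    2 * #{v | c v < c (g v)} = Fintype.card ι * n := by
  have h1 : #{v | ¬ c v < c (g v)} = #{v | c v < c (g v)} := by
    refine card_nbij' g g (fun v hv => ?_) (fun v hv => ?_) (fun v _ => hg v) (fun v _ => hg v)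
    · simp only [coe_filter, mem_univ, true_and, Set.mem_ofPred_eq, not_lt] at hv ⊢
      rw [hg]; exact lt_of_le_of_ne hv (hgc v)
    · simp only [coe_filter, mem_univ, true_and, Set.mem_ofPred_eq, not_lt] at hv ⊢
      rw [hg]; exact hv.le
  have h2 := card_filter_add_card_filter_not (s := (univ : Finset V)) (fun v => c v < c (g v))
  have h3 := card_eq_sum_card_fiberwise (f := c) (s := (univ : Finset V)) (t := univ)
    (fun _ _ => by simp)
  rw [sum_congr rfl fun i _ => hn i, sum_const, smul_eq_mul, card_univ (α := ι)] at h3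
  rw [← h3, ← h2, h1]; ring

end Bounds

/-! ### Perfect matchings as involutions -/

section Matchings

open scoped Classical

variable {V ι : Type*}

/-- The spanning subgraph with edges `{v, f v}` for an involution `f` all of whose edges lie in
`G`. -/
def involutionSubgraph (G : SimpleGraph V) (f : V → V) (hf : Function.Involutive f)
    (hG : ∀ v, G.Adj v (f v)) : G.Subgraph where
  verts := Set.univ
  Adj v w := f v = w
  adj_sub := by rintro v _ rfl; exact hG v
  edge_vert := fun _ => Set.mem_univ _
  symm := ⟨by rintro v _ rfl; exact hf v⟩

theorem isPerfectMatching_involutionSubgraph (G : SimpleGraph V) (f : V → V)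
    (hf : Function.Involutive f) (hG : ∀ v, G.Adj v (f v)) :
    (involutionSubgraph G f hf hG).IsPerfectMatching := by
  rw [SimpleGraph.Subgraph.isPerfectMatching_iff]
  exact fun v => ⟨f v, rfl, fun w hw => Eq.symm hw⟩

theorem SimpleGraph.Subgraph.IsPerfectMatching.exists_involution {G : SimpleGraph V}
    {M : G.Subgraph} (hM : M.IsPerfectMatching) :
    ∃ f : V → V, Function.Involutive f ∧ ∀ v w, M.Adj v w ↔ f v = w := by
  rw [SimpleGraph.Subgraph.isPerfectMatching_iff] at hM
  choose f hf hu using hM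
  have h : ∀ v w, M.Adj v w ↔ f v = w := fun v w =>
    ⟨fun h => (hu v w h).symm, fun h => h ▸ hf v⟩
  exact ⟨f, fun v => (h _ _).1 (hf v).symm, h⟩

/-- As the classes differ, each such edge has a unique endpoint in class `i`. -/
theorem ncard_edgesBetween [Fintype V] [DecidableEq ι] {G : SimpleGraph V} (c : V → ι)
    {M : G.Subgraph} {f : V → V} (hf : ∀ v w, M.Adj v w ↔ f v = w) {i j : ι} (hij : i ≠ j) :
    (edgesBetween c M i j).ncard = #{x | c x = i ∧ c (f x) = j} := by
  rw [← Set.ncard_coe_finset]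
  symm
  refine Set.ncard_congr (fun x _ => s(x, f x)) ?_ ?_ ?_
  · intro x hx
    simp only [coe_filter, mem_univ, true_and, Set.mem_ofPred_eq] at hx
    refine ⟨(hf _ _).2 rfl, ?_⟩
    rw [Sym2.map_mk, hx.1, hx.2]
  · intro x y hx hy hxy
    simp only [coe_filter, mem_univ, true_and, Set.mem_ofPred_eq] at hx hy
    rw [Sym2.eq_iff] at hxy
    rcases hxy with h | h
    · exact h.1
    · exact absurd (by rw [← hx.1, h.1, hy.2]) hij
  · intro e
    induction e with
    | _ x y =>
      rintro ⟨he, hc⟩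
      rw [SimpleGraph.Subgraph.mem_edgeSet] at he
      rw [Sym2.map_mk, Sym2.eq_iff] at hc
      rcases hc with h | h
      · refine ⟨x, ?_, ?_⟩
        · simpa [(hf _ _).1 he] using h
        · simp only [(hf _ _).1 he]
      · refine ⟨y, ?_, ?_⟩
        · simpa [(hf _ _).1 he.symm] using h.symm
        · simp only [(hf _ _).1 he.symm, Sym2.eq_swap]

/-- The partners of one class are spread evenly over the other r - 1 classes, which forces the
common number of edges in a balanced matching to be m. -/
theorem eq_of_card_between_eq [Fintype V] [Fintype ι] [DecidableEq ι] [Nontrivial ι] {c : V → ι}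
    {m k : ℕ} (hn : ∀ i, #{x | c x = i} = (Fintype.card ι - 1) * m) {f : V → V}
    (hfc : ∀ v, c (f v) ≠ c v) (hk : ∀ i j, i ≠ j → #{x | c x = i ∧ c (f x) = j} = k) : k = m := by
  obtain ⟨i⟩ : Nonempty ι := inferInstance
  have h := card_eq_sum_card_fiberwise (f := fun x => c (f x)) (s := ({x | c x = i} : Finset V))
    (t := univ.erase i) (fun x hx => by
      simp only [coe_filter, mem_univ, true_and, Set.mem_ofPred_eq] at hx
      simp only [coe_erase, coe_univ, Set.mem_sdiff, Set.mem_univ, true_and, Set.mem_singleton_iff]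
      rw [← hx]; exact hfc x)
  rw [hn, sum_congr rfl fun j hj => by
    rw [filter_filter, hk i j (ne_of_mem_erase hj).symm], sum_const, smul_eq_mul,
    card_erase_of_mem (mem_univ i), card_univ] at h
  have hc := Fintype.one_lt_card (α := ι)
  exact (Nat.eq_of_mul_eq_mul_left (by omega) h).symm

theorem bpm_eq_card [Fintype V] [Fintype ι] [LinearOrder ι] [Nontrivial ι] {G : SimpleGraph V}
    {c : V → ι} {m : ℕ} (hn : ∀ i, #{x | c x = i} = (Fintype.card ι - 1) * m)
    (hc : ∀ v w, G.Adj v w → c w ≠ c v) :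
    bpm G c = #{f : V → V | IsBalancedInvolution c m f ∧ ∀ v, G.Adj v (f v)} := by
  rw [bpm, ← Set.ncard_coe_finset]
  symm
  have hmem : ∀ f : V → V, f ∈ (({f : V → V | IsBalancedInvolution c m f ∧ ∀ v, G.Adj v (f v)} :
      Finset (V → V)) : Set (V → V)) ↔ IsBalancedInvolution c m f ∧ ∀ v, G.Adj v (f v) := by
    simp
  refine Set.ncard_congr (fun f hf => involutionSubgraph G f ((hmem f).1 hf).1.1 ((hmem f).1 hf).2)
    ?_ ?_ ?_
  · intro f hf
    refine ⟨isPerfectMatching_involutionSubgraph _ _ _ _, m, fun i j hij => ?_⟩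
    rw [ncard_edgesBetween c (f := f) (fun _ _ => Iff.rfl) hij]
    exact ((hmem f).1 hf).1.2.2 i j hij
  · intro f f' hf hf' h
    funext v
    have h1 : (involutionSubgraph G f' ((hmem f').1 hf').1.1 ((hmem f').1 hf').2).Adj v (f v) := by
      rw [← h]; rfl
    exact Eq.symm h1
  · rintro M ⟨hM, k, hk⟩
    obtain ⟨f, hf, hMf⟩ := hM.exists_involution
    have hG : ∀ v, G.Adj v (f v) := fun v => M.adj_sub ((hMf _ _).2 rfl)
    have hk' : ∀ i j, i ≠ j → #{x | c x = i ∧ c (f x) = j} = k := fun i j hij => by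
      rw [← ncard_edgesBetween c hMf hij, hk i j hij]
    have hkm := eq_of_card_between_eq hn (fun v => hc _ _ (hG v)) hk'
    refine ⟨f, (hmem f).2 ⟨⟨hf, fun v => hc _ _ (hG v), fun i j hij => ?_⟩, hG⟩, ?_⟩
    · rw [hk' i j hij, hkm]
    · refine SimpleGraph.Subgraph.ext ?_ ?_
      · exact (Set.eq_univ_of_forall hM.2).symm
      · ext v w
        exact (hMf v w).symm

/-- Label the vertices of class i by pairs (j, t) with j ≠ i and t < m, and match label (j, t) of
class i with label (i, t) of class j. This keeps the denominators nonzero. -/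
theorem exists_isBalancedInvolution [Fintype V] [Fintype ι] [LinearOrder ι] {c : V → ι} {m : ℕ}
    (hn : ∀ i, #{x | c x = i} = (Fintype.card ι - 1) * m) :
    ∃ f : V → V, IsBalancedInvolution c m f := by
  have e : ∀ i, Nonempty ({x // c x = i} ≃ {j // j ≠ i} × Fin m) := fun i => by
    refine ⟨Fintype.equivOfCardEq ?_⟩
    rw [Fintype.card_subtype, hn, Fintype.card_prod, Fintype.card_fin, Fintype.card_subtype_compl,
      Fintype.card_subtype_eq]
  obtain ⟨E⟩ := Classical.nonempty_pi.2 e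
  let f : V → V := fun x =>
    (E (E (c x) ⟨x, rfl⟩).1).symm (⟨c x, (E (c x) ⟨x, rfl⟩).1.2.symm⟩, (E (c x) ⟨x, rfl⟩).2)
  have hf : ∀ i j (h : j ≠ i) t, f ((E i).symm (⟨j, h⟩, t)) = (E j).symm (⟨i, h.symm⟩, t) := by
    intro i j h t
    have hx := ((E i).symm (⟨j, h⟩, t)).2
    have key : ∀ x (hx : c x = i), E i ⟨x, hx⟩ = (⟨j, h⟩, t) →
        f x = (E j).symm (⟨i, h.symm⟩, t) := by
      rintro x rfl hE
      simp only [f]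
      rw [hE]
    exact key _ hx (by simp)
  clear_value f
  have hsurj : ∀ x, ∃ j, ∃ h : j ≠ c x, ∃ t, x = (E (c x)).symm (⟨j, h⟩, t) := fun x =>
    ⟨(E (c x) ⟨x, rfl⟩).1, (E (c x) ⟨x, rfl⟩).1.2, (E (c x) ⟨x, rfl⟩).2, by simp⟩
  have hcE : ∀ i p, c ((E i).symm p) = i := fun i p => ((E i).symm p).2
  refine ⟨f, fun x => ?_, fun x => ?_, fun i j hij => ?_⟩
  · obtain ⟨j, h, t, hx⟩ := hsurj x
    generalize c x = i at h t hx
    rw [hx, hf, hf]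
  · obtain ⟨j, h, t, hx⟩ := hsurj x
    have : f x = (E j).symm (⟨c x, h.symm⟩, t) := by
      rw [← hf (c x) j h t, ← hx]
    rw [this, hcE]
    exact h
  · rw [← Fintype.card_fin m, ← card_univ]
    symm
    refine card_bij (fun t _ => (E i).symm (⟨j, hij.symm⟩, t)) (fun t _ => ?_) (fun t _ t' _ h => ?_)
      fun x hx => ?_
    · simp [hf, hcE]
    · have := (E i).symm.injective (Subtype.ext h)
      exact (Prod.ext_iff.1 this).2
    · simp only [mem_filter, mem_univ, true_and] at hx
      obtain ⟨rfl, h2⟩ := hx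
      obtain ⟨j', h, t, hx⟩ := hsurj x
      have : f x = (E j').symm (⟨c x, h.symm⟩, t) := by
        rw [← hf (c x) j' h t, ← hx]
      rw [this, hcE] at h2
      subst h2
      exact ⟨t, mem_univ _, hx.symm⟩

end Matchings

/-! ### Binomial moments -/

section Limit

open scoped Classical

variable {V ι : Type*} [Fintype V] [LinearOrder ι]

/-- The `k`-th binomial moment of the number of edges `{v, g v}`, `v ∈ R`, in a uniformly random
balanced perfect matching. -/
noncomputable def binomialMoment (c : V → ι) (m : ℕ) (g : V → V) (R : Finset V) (k : ℕ) : ℝ :=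
  ∑ S ∈ R.powersetCard k, (#(balancedExtensions c m g S) : ℝ) / #(balancedExtensions c m g ∅)

/-- Moments beyond |R| vanish; the infinite sum is the form suited to dominated convergence. -/
theorem card_avoiding_div_eq_tsum (c : V → ι) (m : ℕ) (g : V → V) (R : Finset V) :
    (#(balancedAvoiding c m g R) : ℝ) /
      #(balancedExtensions c m g ∅) = ∑' k, (-1) ^ k * binomialMoment c m g R k := by
  have h : (#(balancedAvoiding c m g R) : ℝ) =
      ∑ S ∈ R.powerset, (-1) ^ #S * (#(balancedExtensions c m g S) : ℝ) := by
    exact_mod_cast card_balancedAvoiding c m g R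
  rw [tsum_eq_sum (s := range (#R + 1)), h, sum_powerset, sum_div]
  · refine sum_congr rfl fun k _ => ?_
    rw [binomialMoment, mul_sum, sum_div]
    refine sum_congr rfl fun S hS => ?_
    rw [(mem_powersetCard.1 hS).2, mul_div_assoc]
  · intro k hk
    rw [mem_range, not_lt] at hk
    rw [binomialMoment, powersetCard_eq_empty.2 (by omega)]
    simp

theorem binomialMoment_nonneg (c : V → ι) (m : ℕ) (g : V → V) (R : Finset V) (k : ℕ) :
    0 ≤ binomialMoment c m g R k := sum_nonneg fun _ _ => by positivity

theorem binomialMoment_le {c : V → ι} {m : ℕ} {g : V → V} {R : Finset V} {k : ℕ} {q : ℝ}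
    (h : ∀ S ⊆ R, #S = k →
      (#(balancedExtensions c m g S) : ℝ) / #(balancedExtensions c m g ∅) ≤ q) :
    binomialMoment c m g R k ≤ (#R).choose k * q := by
  refine (sum_le_card_nsmul _ _ q fun S hS => ?_).trans_eq ?_
  · exact h S (mem_powersetCard.1 hS).1 (mem_powersetCard.1 hS).2
  · rw [card_powersetCard, nsmul_eq_mul]

theorem le_binomialMoment {c : V → ι} {m : ℕ} {g : V → V} {R : Finset V} {k : ℕ} {q : ℝ}
    (h : ∀ S ⊆ R, #S = k →
      q ≤ (#(balancedExtensions c m g S) : ℝ) / #(balancedExtensions c m g ∅)) :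
    (#R).choose k * q ≤ binomialMoment c m g R k := by
  refine Eq.trans_le ?_ (card_nsmul_le_sum _ _ q fun S hS => ?_)
  · rw [card_powersetCard, nsmul_eq_mul]
  · exact h S (mem_powersetCard.1 hS).1 (mem_powersetCard.1 hS).2

variable {c : V → ι} {n m : ℕ} {g : V → V} {R : Finset V}

theorem binomialMoment_le_of_lt (hn : ∀ i, #{x | c x = i} = n) (hg : Function.Involutive g)
    (hR : ∀ w ∈ R, c w < c (g w)) (h0 : 0 < #(balancedExtensions c m g ∅)) {k : ℕ}
    (hk : 2 * k < n) :
    binomialMoment c m g R k ≤ (#R).choose k * ((m : ℝ) / ((n : ℝ) - 2 * k) ^ 2) ^ k := by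
  refine binomialMoment_le fun S hS hSk => ?_
  have h := card_extensions_mul_pow_le hn m hg (fun w hw => hR w (hS hw)) hSk.le
  rw [hSk] at h
  have h' : (#(balancedExtensions c m g S) : ℝ) * ((n : ℝ) - 2 * k) ^ (2 * k) ≤
      #(balancedExtensions c m g ∅) * (m : ℝ) ^ k := by
    have : ((n - 2 * k : ℕ) : ℝ) = (n : ℝ) - 2 * k := by rw [Nat.cast_sub hk.le]; simp
    rw [← this]; exact_mod_cast h
  have hpos : (0 : ℝ) < (n : ℝ) - 2 * k := by
    have : ((2 * k : ℕ) : ℝ) < n := by exact_mod_cast hk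
    push_cast at this; linarith
  rw [div_pow, ← pow_mul, div_le_div_iff₀ (by exact_mod_cast h0) (by positivity)]
  linarith

theorem le_binomialMoment_of_le (hn : ∀ i, #{x | c x = i} = n) (hg : Function.Involutive g)
    (hR : ∀ w ∈ R, c w < c (g w)) (h0 : 0 < #(balancedExtensions c m g ∅)) (hn0 : 0 < n) {k : ℕ}
    (hk : k ≤ m) :
    (#R).choose k * (((m : ℝ) - k) / (n : ℝ) ^ 2) ^ k ≤ binomialMoment c m g R k := by
  refine le_binomialMoment fun S hS hSk => ?_
  have h := le_card_extensions_mul_pow hn m hg (fun w hw => hR w (hS hw)) hSk.le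
  rw [hSk] at h
  have h' : (#(balancedExtensions c m g ∅) : ℝ) * ((m : ℝ) - k) ^ k ≤
      #(balancedExtensions c m g S) * (n : ℝ) ^ (2 * k) := by
    rw [← Nat.cast_sub hk]; exact_mod_cast h
  rw [div_pow, ← pow_mul, div_le_div_iff₀ (by positivity) (by exact_mod_cast h0)]
  linarith

theorem binomialMoment_le_exp [Fintype ι] (hn : ∀ i, #{x | c x = i} = n)
    (hg : Function.Involutive g) (hR : ∀ w ∈ R, c w < c (g w))
    (h0 : 0 < #(balancedExtensions c m g ∅)) (hn0 : 0 < n) (k : ℕ) :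
    binomialMoment c m g R k ≤
      (Real.exp 1 ^ 2 * (#R * (m : ℝ) / (n : ℝ) ^ 2)) ^ k / k.factorial := by
  have h1 : binomialMoment c m g R k ≤
      (#R).choose k * (Real.exp 1 ^ 2 * (m : ℝ) / (n : ℝ) ^ 2) ^ k := by
    refine binomialMoment_le fun S hS hSk => ?_
    have h := card_extensions_mul_pow_le_exp hn m hg (fun w hw => hR w (hS hw))
    rw [hSk] at h
    rw [div_pow, ← pow_mul, div_le_div_iff₀ (by exact_mod_cast h0) (by positivity), mul_pow,
      ← pow_mul]
    linarith
  refine h1.trans ?_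
  calc _ ≤ ((#R : ℝ) ^ k / k.factorial) * (Real.exp 1 ^ 2 * (m : ℝ) / (n : ℝ) ^ 2) ^ k := by
        gcongr; exact Nat.choose_le_pow_div _ _
    _ = _ := by
        rw [div_mul_eq_mul_div, ← mul_pow]
        congr 2; ring

end Limit

/-! ### Passage to the limit -/

open Filter Topology

theorem tendsto_choose_mul_pow {N : ℕ → ℕ} {p : ℕ → ℝ} {l : ℝ} (hN : Tendsto N atTop atTop)
    (h : Tendsto (fun m => N m * p m) atTop (𝓝 l)) (k : ℕ) :
    Tendsto (fun m => (N m).choose k * p m ^ k) atTop (𝓝 (l ^ k / k.factorial)) := by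
  have h1 := ((isEquivalent_choose k).comp_tendsto hN).mul
    (Asymptotics.IsEquivalent.refl (u := fun m => p m ^ k))
  refine h1.symm.tendsto_nhds ?_
  convert (h.pow k).div_const (k.factorial : ℝ) using 2 with m
  simp only [Pi.mul_apply, Function.comp_apply]
  ring

theorem tendsto_alternating_tsum {l C : ℝ} {a : ℕ → ℕ → ℝ} (ha0 : ∀ m k, 0 ≤ a m k)
    (ha : ∀ k, Tendsto (fun m => a m k) atTop (𝓝 (l ^ k / k.factorial)))
    (hC : ∀ᶠ m in atTop, ∀ k, a m k ≤ C ^ k / k.factorial) :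
    Tendsto (fun m => ∑' k, (-1) ^ k * a m k) atTop (𝓝 (Real.exp (-l))) := by
  rw [Real.exp_eq_exp_ℝ, NormedSpace.exp_eq_tsum_div]
  refine tendsto_tsum_of_dominated_convergence (Real.summable_pow_div_factorial C) (fun k => ?_) ?_
  · convert (ha k).const_mul ((-1) ^ k) using 2
    rw [← mul_div_assoc, ← mul_pow, neg_one_mul]
  · filter_upwards [hC] with m hm k
    rw [norm_mul, norm_pow, norm_neg, norm_one, one_pow, one_mul, Real.norm_of_nonneg (ha0 m k)]
    exact hm k

theorem tendsto_div_sub_const {s : ℝ} (hs : s ≠ 0) (b : ℝ) :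
    Tendsto (fun m : ℕ => (m : ℝ) / (s * m - b)) atTop (𝓝 s⁻¹) := by
  have h : Tendsto (fun m : ℕ => (s - b * (m : ℝ)⁻¹)⁻¹) atTop (𝓝 s⁻¹) := by
    have := (tendsto_inv_atTop_nhds_zero_nat (𝕜 := ℝ)).const_mul b
    have := (tendsto_const_nhds (x := s)).sub this
    rw [mul_zero, sub_zero] at this
    exact this.inv₀ hs
  refine h.congr' ?_
  filter_upwards [eventually_gt_atTop 0] with m hm
  have : (m : ℝ) ≠ 0 := by positivity
  rw [show s * (m : ℝ) - b = m * (s - b * (m : ℝ)⁻¹) by field_simp, div_mul_cancel_left₀ this]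

theorem theorem3p2 (r : ℕ) (hr : 3 ≤ r)
    (M : ∀ m : ℕ, (SimpleGraph.completeEquipartiteGraph r ((r - 1) * m)).Subgraph)
    (hM : ∀ m : ℕ, (M m).IsPerfectMatching) :
    Filter.Tendsto
      (fun m : ℕ =>
        (bpm ((SimpleGraph.completeEquipartiteGraph r ((r - 1) * m)).deleteEdges (M m).edgeSet)
            Prod.fst : ℝ) /
          (bpm (SimpleGraph.completeEquipartiteGraph r ((r - 1) * m)) Prod.fst : ℝ))
      Filter.atTop (nhds (Real.exp (-(r : ℝ) / (2 * (r : ℝ) - 2)))) := by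
  have : Nontrivial (Fin r) := Fin.nontrivial_iff_two_le.2 (by omega)
  choose g hg hMg using fun m => (hM m).exists_involution
  have hgc : ∀ m v, (g m v).1 ≠ v.1 := fun m v =>
    ((M m).adj_sub ((hMg m _ _).2 rfl)).symm
  let R : ∀ m, Finset (Fin r × Fin ((r - 1) * m)) := fun m => {v | v.1 < (g m v).1}
  have hR : ∀ m, ∀ v ∈ R m, v.1 < (g m v).1 := fun m v hv => (mem_filter.1 hv).2
  have hn : ∀ m, ∀ i : Fin r, #{x : Fin r × Fin ((r - 1) * m) | x.1 = i} = (r - 1) * m := by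
    intro m i
    have : ({x : Fin r × Fin ((r - 1) * m) | x.1 = i} : Finset _) = {i} ×ˢ univ := by
      ext x; simp only [mem_filter, mem_univ, true_and, mem_product, mem_singleton, and_true]
    rw [this]; simp
  have hn' : ∀ m, ∀ i : Fin r, #{x : Fin r × Fin ((r - 1) * m) | x.1 = i} =
      (Fintype.card (Fin r) - 1) * m := by simpa using hn
  have h0 : ∀ m, 0 < #(balancedExtensions Prod.fst m (g m) ∅) := fun m => by
    obtain ⟨f, hf⟩ := exists_isBalancedInvolution (hn' m)
    exact card_pos.2 ⟨f, by simp [balancedExtensions, hf]⟩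
  have hden : ∀ m, bpm (SimpleGraph.completeEquipartiteGraph r ((r - 1) * m)) Prod.fst =
      #(balancedExtensions Prod.fst m (g m) ∅) := fun m => by
    rw [bpm_eq_card (hn' m) (fun v w h => Ne.symm h), balancedExtensions]
    congr 1
    ext f
    simp only [mem_filter, mem_univ, true_and, notMem_empty, false_imp_iff, implies_true, and_true,
      and_iff_left_iff_imp]
    exact fun hf v => (hf.2.1 v).symm
  have hnum : ∀ m, bpm ((SimpleGraph.completeEquipartiteGraph r ((r - 1) * m)).deleteEdges
      (M m).edgeSet) Prod.fst = #(balancedAvoiding Prod.fst m (g m) (R m)) := fun m => by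
    rw [bpm_eq_card (hn' m) (fun v w h => Ne.symm (SimpleGraph.deleteEdges_adj.1 h).1),
      balancedAvoiding]
    congr 1
    ext f
    simp only [mem_filter, mem_univ, true_and, SimpleGraph.deleteEdges_adj,
      SimpleGraph.Subgraph.mem_edgeSet, hMg]
    refine and_congr_right fun hf => ⟨fun h v _ => Ne.symm (h v).2, fun h v =>
      ⟨(hf.2.1 v).symm, fun hv => ?_⟩⟩
    -- Avoidance is assumed only at lower endpoints; an upper endpoint `v` is handled through its
    -- partner `g m v`.
    rcases lt_or_gt_of_ne (hgc m v) with hlt | hlt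
    · refine h (g m v) (mem_filter.2 ⟨mem_univ _, by rwa [hg]⟩) ?_
      rw [hg, hv, hf.1]
    · exact h v (mem_filter.2 ⟨mem_univ _, hlt⟩) hv.symm
  simp only [hden, hnum, card_avoiding_div_eq_tsum]
  have hr1 : (0 : ℝ) < (r : ℝ) - 1 := by
    have : (3 : ℝ) ≤ r := by exact_mod_cast hr
    linarith
  have hcast : ∀ m : ℕ, (((r - 1) * m : ℕ) : ℝ) = ((r : ℝ) - 1) * m := fun m => by
    rw [Nat.cast_mul, Nat.cast_sub (by omega), Nat.cast_one]
  have hRcard : ∀ m, 2 * #(R m) = r * ((r - 1) * m) := fun m => by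
    simpa using two_mul_card_lower_endpoints (hn m) (hg m) (hgc m)
  have hRcard' : ∀ m, (#(R m) : ℝ) = r * (((r : ℝ) - 1) * m) / 2 := fun m => by
    rw [← hcast, eq_div_iff two_ne_zero, mul_comm]
    exact_mod_cast hRcard m
  have hRtop : Tendsto (fun m => #(R m)) atTop atTop := by
    refine tendsto_atTop_mono (fun m => ?_) tendsto_id
    have h1 : 2 * (1 * m) ≤ r * ((r - 1) * m) := by gcongr <;> omega
    have h2 := hRcard m
    simp only [id]
    omega
  have hnpos : ∀ m, 0 < m → 0 < (r - 1) * m := fun m hm => Nat.mul_pos (by omega) hm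
  rw [show -(r : ℝ) / (2 * r - 2) = -(r / (2 * (r - 1))) by rw [neg_div]; congr 2; ring]
  -- For m > 0, |R|·m/n² equals l = r/(2(r-1)) exactly, so `binomialMoment_le_exp` gives this `C`.
  refine tendsto_alternating_tsum (C := Real.exp 1 ^ 2 * (r / (2 * (r - 1))))
    (fun m k => binomialMoment_nonneg _ _ _ _ _) (fun k => ?_) ?_
  · refine tendsto_of_tendsto_of_tendsto_of_le_of_le'
      (g := fun m => ((#(R m)).choose k : ℝ) *
        (((m : ℝ) - k) / (((r - 1) * m : ℕ) : ℝ) ^ 2) ^ k)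
      (h := fun m => ((#(R m)).choose k : ℝ) *
        ((m : ℝ) / ((((r - 1) * m : ℕ) : ℝ) - 2 * k) ^ 2) ^ k) ?_ ?_ ?_ ?_
    · refine tendsto_choose_mul_pow hRtop ?_ k
      -- |R|(m - k)/n² is l(1 - k/m).
      have h1 : Tendsto (fun m : ℕ => (r / (2 * (r - 1)) : ℝ) * (1 - k * (m : ℝ)⁻¹)) atTop
          (𝓝 (r / (2 * (r - 1)) * (1 - k * 0))) :=
        ((tendsto_const_nhds.sub
          ((tendsto_inv_atTop_nhds_zero_nat (𝕜 := ℝ)).const_mul _))).const_mul _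
      rw [mul_zero, sub_zero, mul_one] at h1
      refine h1.congr' ?_
      filter_upwards [eventually_gt_atTop 0] with m hm
      have : (m : ℝ) ≠ 0 := by positivity
      rw [hRcard', hcast]
      field_simp
    · refine tendsto_choose_mul_pow hRtop ?_ k
      have h1 := ((tendsto_div_sub_const hr1.ne' (2 * k)).pow 2).const_mul
        ((r : ℝ) * ((r : ℝ) - 1) / 2)
      convert h1 using 2 with m
      · rw [hRcard', hcast, div_pow]
        generalize (((r : ℝ) - 1) * m - 2 * k) ^ 2 = d
        ring
      · field_simp
    · filter_upwards [eventually_ge_atTop k, eventually_gt_atTop 0] with m hm hm0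
      exact le_binomialMoment_of_le (hn m) (hg m) (hR m) (h0 m) (hnpos m hm0) hm
    · filter_upwards [eventually_gt_atTop (2 * k)] with m hm
      refine binomialMoment_le_of_lt (hn m) (hg m) (hR m) (h0 m) ?_
      have : 1 * m ≤ (r - 1) * m := by gcongr; omega
      omega
  · filter_upwards [eventually_gt_atTop 0] with m hm k
    refine (binomialMoment_le_exp (hn m) (hg m) (hR m) (h0 m) (hnpos m hm) k).trans_eq ?_
    have : (m : ℝ) ≠ 0 := by positivity
    rw [hRcard', hcast]
    congr 3
    field_simp
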